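/- Let $K$ be a compact line, i.e. a nonempty linearly ordered set that is compact in its order topology, with minimum $0_K$ and maximum $1_K$. Call $x\in K$ left-isolated if it has an immediate predecessor $x^-$, and right-isolated if it has an immediate successor; $x\neq 0_K$ is left-dense if it is not left-isolated, and $x\ne 1_K$ is right-dense if it is not right-isolated. **Integral.** For $a\le b$ in $K$, a tagged partition of $[a,b]$ consists of points $a=x_0\le x_1\le\dots\le x_n=b$ and tags $t_i\in[x_{i-1},x_i]$. A gauge $\delta$ assigns to each point $t$ an open interval (open order-convex set) $\delta(t)\ni t$; the partition is $\delta$-fine if $(x_{i-1},x_i]\subset\delta(t_i)$ for all $i$. For $f,G:K\to\mathbb R$, $f$ is $G$-integrable on $[a,b]$ with $\int_a^b f\,dG=A$ if for every $\varepsilon>0$ there is a gauge $\delta$ such that $$\Bigl|f(a)G(a)+\sum_{i=1}^n f(t_i)\bigl(G(x_i)-G(x_{i-1})\bigr)-A\Bigr|<\varepsilon$$ for every $\delta$-fine tagged partition of $[a,b]$. "$G$-integrable" means $G$-integrable on $[0_K,1_K]$. **Null sets.** For $G:K\to\mathbb R$ nondecreasing, nonnegative and right-continuous, $\mu_G$ is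 the unique Radon (regular Borel) measure on $K$ with $\mu_G([0_K,x])=G(x)$ for all $x\in K$; a set is $G$-null if its outer $\mu_G$-measure is $0$. **Derivative.** For $h:K\to\mathbb R$ let $L_h(0_K)=0$, $L_h(x)=h(x^-)$ if $x$ is left-isolated, and $L_h(x)=\lim_{y\nearrow x}h(y)$ if $x$ is left-dense and the limit exists. Let $F:K\to\mathbb R$, $D\in\mathbb R$. If $L_G(x)=G(x)$, then $\frac{dF}{dG}(x)=D$ means: $F(x)=L_F(x)$ if $x$ is left-isolated; $G$ is not constant on any neighbourhood of $x$; and for every $\varepsilon>0$ there is a neighbourhood $V$ of $x$ with $|F(y)-F(x)-D(G(y)-G(x))|\le\varepsilon|G(y)-G(x)|$ for all $y\in V$. If $L_G(x)\ne G(x)$, it means: $F$ is regulated at $x$ (i.e. $\lim_{y\nearrow x}F(y)$ exists if $x$ is left-dense, and $\lim_{y\searrow x}F(y)=F(x)$ if $x$ is right-dense); and for every $\varepsilon>0$ there is a neighbourhood $V$ of $x$ with $|F(y)-L_F(x)-D(G(y)-L_G(x))|\le\varepsilon|G(y)-L_G(x)|$ for all $y\in V\cap[x,1_K]$. **Theorem.**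 Let $K$ be a compact line, let $G:K\to\mathbb R$ be nondecreasing, nonnegative and right-continuous, and let $f:K\to\mathbb R$ be $G$-integrable. Then $f$ is $G$-integrable on $[0_K,x]$ for every $x\in K$, so that $F(x)=\int_{0_K}^x f\,dG$ defines a function $F:K\to\mathbb R$, and there is a $G$-null set $\mathcal Z\subset K$ such that for every $x\in K\setminus\mathcal Z$ the derivative $\frac{dF}{dG}(x)$ exists and $$\frac{dF}{dG}(x)=f(x).$$ -/

import Mathlib

open Set Filter Topology MeasureTheory

namespace CompactLine

noncomputable section

section Integral

variable {K : Type*} [LinearOrder K]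

/-- A tagged partition of `[a, b]`: points `a = pt 0 ≤ pt 1 ≤ ⋯ ≤ pt n = b`, and for each `i < n` a
tag in `[pt i, pt (i + 1)]`. Values of `pt` beyond `n`, and of `tag` from `n` on, are irrelevant. -/
structure TaggedPartition (a b : K) where
  n : ℕ
  pt : ℕ → K
  tag : ℕ → K
  pt_zero : pt 0 = a
  pt_last : pt n = b
  pt_le : ∀ i < n, pt i ≤ pt (i + 1)
  tag_mem : ∀ i < n, tag i ∈ Icc (pt i) (pt (i + 1))

/-- The Riemann sum `f(a) G(a) + ∑ f(tᵢ) (G(xᵢ) - G(xᵢ₋₁))` of a partition of `[a, b]`. -/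
def TaggedPartition.riemannSum {a b : K} (P : TaggedPartition a b) (G f : K → ℝ) : ℝ :=
  f a * G a + ∑ i ∈ Finset.range P.n, f (P.tag i) * (G (P.pt (i + 1)) - G (P.pt i))

/-- `P` is `δ`-fine if every `(xᵢ₋₁, xᵢ]` is contained in `δ(tᵢ)`. The left endpoint is left out: a
gauge may separate two consecutive points of `K`, and then no partition would be fine with closed
intervals in place of the half-open ones. -/
def TaggedPartition.IsFine {a b : K} (P : TaggedPartition a b) (δ : K → Set K) : Prop :=
  ∀ i < P.n, Ioc (P.pt i) (P.pt (i + 1)) ⊆ δ (P.tag i)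

variable [TopologicalSpace K]

/-- A gauge assigns to each point an open interval (an open order-convex set) containing it. -/
def IsGauge (δ : K → Set K) : Prop :=
  ∀ x, IsOpen (δ x) ∧ (δ x).OrdConnected ∧ x ∈ δ x

/-- `A` is the Kurzweil--Stieltjes integral of `f` with respect to `G` on the compact line
`[a, b]`. For `a = ⊥`, `b = ⊤` this is the integral over `K`. A gauge on `[a, b]` is the trace of a
gauge on `K`; only its values at points of `[a, b]` matter. -/
def HasGIntegral (G f : K → ℝ) (a b : K) (A : ℝ) : Prop :=
  ∀ ε > 0, ∃ δ : K → Set K, IsGauge δ ∧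
    ∀ P : TaggedPartition a b, P.IsFine δ → |P.riemannSum G f - A| < ε

/-- `f` is `G`-integrable on `[a, b]`. -/
def GIntegrable (G f : K → ℝ) (a b : K) : Prop :=
  ∃ A, HasGIntegral G f a b A

open scoped Classical in
/-- The integral `∫_a^b f dG`, with the value `0` if `f` is not `G`-integrable on `[a, b]`. -/
def gIntegral (G f : K → ℝ) (a b : K) : ℝ :=
  if h : GIntegrable G f a b then h.choose else 0

end Integral

section Null

variable {K : Type*} [LinearOrder K] [TopologicalSpace K] [MeasurableSpace K] [BorelSpace K]

/-- `μ` is the Radon measure `μ_G` induced by a nondecreasing, nonnegative, right-continuous `G`: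
the regular Borel measure with `μ [0_K, x] = G x` for all `x`. On a compact line there is exactly
one. -/
structure IsInducedMeasure (G : K → ℝ) (μ : Measure K) : Prop where
  regular : μ.Regular
  measure_Iic : ∀ x, μ (Iic x) = ENNReal.ofReal (G x)

/-- `A` has outer measure zero with respect to the Radon measure induced by `G` (`μ A` is the outer
measure of `A` if `A` is not measurable). -/
def IsGNull (G : K → ℝ) (A : Set K) : Prop :=
  ∃ μ : Measure K, IsInducedMeasure G μ ∧ μ A = 0

end Null

section Derivative

variable {K : Type*} [LinearOrder K]

/-- `x` has an immediate predecessor. -/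
def LeftIsolated (x : K) : Prop := ∃ y, y ⋖ x

/-- `x` has an immediate successor. -/
def RightIsolated (x : K) : Prop := ∃ y, x ⋖ y

variable [BoundedOrder K]

/-- `x` is not the minimum and not left-isolated. -/
def LeftDense (x : K) : Prop := x ≠ ⊥ ∧ ¬ LeftIsolated x

/-- `x` is not the maximum and not right-isolated. -/
def RightDense (x : K) : Prop := x ≠ ⊤ ∧ ¬ RightIsolated x

variable [TopologicalSpace K]

open scoped Classical in
/-- The function `L_G`: it is `0` at the minimum, `G(x⁻)` at a left-isolated point `x` with
immediate predecessor `x⁻`, and the limit of `G` from the left at a left-dense point (meaningful if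
that limit exists). -/
def leftValue (G : K → ℝ) (x : K) : ℝ :=
  if x = ⊥ then 0
  else if h : LeftIsolated x then G h.choose
  else limUnder (𝓝[<] x) G

/-- `f` is regulated at `x`: it has a limit from the left if `x` is left-dense, and it tends to
`f x` from the right if `x` is right-dense. -/
def RegulatedAt (f : K → ℝ) (x : K) : Prop :=
  (LeftDense x → ∃ l, Tendsto f (𝓝[<] x) (𝓝 l)) ∧
    (RightDense x → Tendsto f (𝓝[>] x) (𝓝 (f x)))

/-- `F` is `G`-differentiable at `x`, with `G`-derivative `D`. -/
def HasGDerivAt (G F : K → ℝ) (D : ℝ) (x : K) : Prop :=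
  (leftValue G x = G x ∧
    (LeftIsolated x → F x = leftValue F x) ∧
    (∀ V ∈ 𝓝 x, ¬ ∃ c, ∀ y ∈ V, G y = c) ∧
    ∀ ε > 0, ∃ V ∈ 𝓝 x, ∀ y ∈ V,
      |F y - F x - D * (G y - G x)| ≤ ε * |G y - G x|) ∨
  (leftValue G x ≠ G x ∧
    RegulatedAt F x ∧
    ∀ ε > 0, ∃ V ∈ 𝓝 x, ∀ y ∈ V ∩ Ici x,
      |F y - leftValue F x - D * (G y - leftValue G x)| ≤ ε * |G y - leftValue G x|)

end Derivative

end

end CompactLine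

/-!
Write `F x = ∫ f dG` over `[⊥, x]`. Fine Riemann sums exist on every interval (Cousin's lemma), and
the Cauchy criterion makes `f` integrable on every `[⊥, x]`. The Saks–Henstock lemma
`abs_sum_le_of_fine` says that a gauge good for the whole integral is good for every finite family
of non-overlapping fine intervals.

Applied to a single interval, it controls `F y - F x - f x * (G y - G x)` for `y` near `x`. This
gives the one-sided limits of `F`, shows that the jump of `F` at `x` is `f x` times that of `G`
(`sub_leftValue_indefinite`), and settles differentiability at every jump of `G`.

At the remaining points, those where `G` is locally constant are null
(`inducedMeasure_locallyConstant_eq_zero`). For `c > 0`, let `E` be the set of points without jump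
near which the error `|F y - F x - f x * (G y - G x)|` exceeds `c * |G y - G x|` for suitable `y`
arbitrarily close to `x`. The map `G` carries the intervals between such `x` and `y` to
nondegenerate real intervals, so that the Vitali covering theorem of the line applies: disjoint
ones among them cover `G '' E` after enlargement, and by Saks–Henstock their total length is small.
Hence `G '' E` is Lebesgue null (`volume_image_eq_zero`).

The Radon measure of `G` is realized as the law of the generalized inverse `quantile G` under
Lebesgue measure on `(0, G ⊤]`. This map is left-continuous, which on the line suffices for Borel
measurability and for regularity of the law, although `K` need not be second countable. On
non-atoms it inverts `G`, so there `G`-null sets may be recognized by their images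
(`inducedMeasure_le_volume_image`).
-/

namespace CompactLine

/-! ### Fine Riemann sums and Cousin's lemma -/

section FineSum

variable {K : Type*} [LinearOrder K] {G f : K → ℝ} {δ δ' : K → Set K} {a b c : K} {S S' : ℝ}

/-- `FineSum G f δ a b S` says that `S` is the sum `∑ f(tᵢ) (G(xᵢ) - G(xᵢ₋₁))` of some `δ`-fine
tagged partition of `[a, b]`. The term `f(a) G(a)` is left out, so that these sums are additive
under concatenation of partitions. -/
inductive FineSum (G f : K → ℝ) (δ : K → Set K) (a : K) : K → ℝ → Prop
  | nil : FineSum G f δ a a 0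
  | snoc {b c t : K} {S : ℝ} : FineSum G f δ a b S → b ≤ c → t ∈ Icc b c → Ioc b c ⊆ δ t →
      FineSum G f δ a c (S + f t * (G c - G b))

theorem FineSum.le (h : FineSum G f δ a b S) : a ≤ b := by
  induction h with
  | nil => exact le_rfl
  | snoc _ hbc _ _ ih => exact ih.trans hbc

theorem FineSum.trans (h : FineSum G f δ a b S) (h' : FineSum G f δ b c S') :
    FineSum G f δ a c (S + S') := by
  induction h' with
  | nil => simpa using h
  | snoc _ hbc ht hδ ih => rw [← add_assoc]; exact ih.snoc hbc ht hδ

theorem FineSum.mono (h : FineSum G f δ a b S) (hδ : ∀ x, δ x ⊆ δ' x) :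
    FineSum G f δ' a b S := by
  induction h with
  | nil => exact .nil
  | snoc _ hbc ht hs ih => exact ih.snoc hbc ht (hs.trans (hδ _))

theorem FineSum.eq_zero_of_eq (hG : Monotone G) (h : FineSum G f δ a b S) (hab : G a = G b) :
    S = 0 := by
  induction h with
  | nil => rfl
  | @snoc b c t S h hbc ht hs ih =>
    have h1 : G a = G b := le_antisymm (hG h.le) (hab ▸ hG hbc)
    rw [ih h1, ← hab, h1]
    simp

theorem TaggedPartition.IsFine.fineSum {P : TaggedPartition a b} (hP : P.IsFine δ) :
    ∃ S, FineSum G f δ a b S ∧ P.riemannSum G f = f a * G a + S := by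
  have key : ∀ m ≤ P.n, FineSum G f δ a (P.pt m)
      (∑ i ∈ Finset.range m, f (P.tag i) * (G (P.pt (i + 1)) - G (P.pt i))) := by
    intro m
    induction m with
    | zero => intro _; rw [P.pt_zero]; exact .nil
    | succ m ih =>
      intro hm
      rw [Finset.sum_range_succ]
      exact (ih (by omega)).snoc (P.pt_le m hm) (P.tag_mem m hm) (hP m hm)
  have h := key P.n le_rfl
  rw [P.pt_last] at h
  exact ⟨_, h, rfl⟩

theorem FineSum.exists_taggedPartition (h : FineSum G f δ a b S) :
    ∃ P : TaggedPartition a b, P.IsFine δ ∧ P.riemannSum G f = f a * G a + S := by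
  induction h with
  | nil =>
    exact ⟨⟨0, fun _ => a, fun _ => a, rfl, rfl, by simp, by simp⟩,
      fun i hi => absurd hi (by simp), by simp [TaggedPartition.riemannSum]⟩
  | @snoc b c t S h hbc ht hs ih =>
    obtain ⟨P, hP, hsum⟩ := ih
    have hlt : ∀ i < P.n + 1, i < P.n ∨ i = P.n := fun i hi => by omega
    refine ⟨⟨P.n + 1, fun i => if i ≤ P.n then P.pt i else c,
      fun i => if i < P.n then P.tag i else t, by simp [P.pt_zero], by simp, ?_, ?_⟩, ?_, ?_⟩
    · intro i hi
      rcases hlt i hi with hi | rfl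
      · simpa [hi.le, Nat.succ_le_of_lt hi] using P.pt_le i hi
      · simpa [P.pt_last] using hbc
    · intro i hi
      rcases hlt i hi with hi | rfl
      · simpa [hi, hi.le, Nat.succ_le_of_lt hi] using P.tag_mem i hi
      · simpa [P.pt_last] using ht
    · intro i hi
      rcases hlt i hi with hi | rfl
      · simpa [hi, hi.le, Nat.succ_le_of_lt hi] using hP i hi
      · simpa [P.pt_last] using hs
    · have hcongr : ∑ i ∈ Finset.range P.n, f (if i < P.n then P.tag i else t) *
          (G (if i + 1 ≤ P.n then P.pt (i + 1) else c) - G (if i ≤ P.n then P.pt i else c)) =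
          ∑ i ∈ Finset.range P.n, f (P.tag i) * (G (P.pt (i + 1)) - G (P.pt i)) := by
        refine Finset.sum_congr rfl fun i hi => ?_
        have hi := Finset.mem_range.1 hi
        simp [hi, hi.le, Nat.succ_le_of_lt hi]
      simp only [TaggedPartition.riemannSum] at hsum ⊢
      rw [Finset.sum_range_succ, hcongr, ← add_assoc, hsum]
      simp [P.pt_last, add_assoc]

variable [TopologicalSpace K]

theorem hasGIntegral_iff {A : ℝ} :
    HasGIntegral G f a b A ↔ ∀ ε > 0, ∃ δ : K → Set K, IsGauge δ ∧
      ∀ S, FineSum G f δ a b S → |f a * G a + S - A| < ε := by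
  refine forall₂_congr fun ε _ => exists_congr fun δ => and_congr_right fun _ => ⟨?_, ?_⟩
  · intro h S hS
    obtain ⟨P, hP, hsum⟩ := hS.exists_taggedPartition
    rw [← hsum]
    exact h P hP
  · intro h P hP
    obtain ⟨S, hS, hsum⟩ := hP.fineSum (G := G) (f := f)
    rw [hsum]
    exact h S hS

theorem IsGauge.mem_nhds (hδ : IsGauge δ) (x : K) : δ x ∈ 𝓝 x :=
  (hδ x).1.mem_nhds (hδ x).2.2

theorem IsGauge.inter (hδ : IsGauge δ) (hδ' : IsGauge δ') : IsGauge fun x => δ x ∩ δ' x :=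
  fun x => ⟨(hδ x).1.inter (hδ' x).1, (hδ x).2.1.inter (hδ' x).2.1, (hδ x).2.2, (hδ' x).2.2⟩

theorem isGauge_univ : IsGauge fun _ : K => (univ : Set K) :=
  fun _ => ⟨isOpen_univ, ordConnected_univ, mem_univ _⟩

theorem GIntegrable.hasGIntegral (h : GIntegrable G f a b) :
    HasGIntegral G f a b (gIntegral G f a b) := by
  rw [gIntegral, dif_pos h]
  exact h.choose_spec

theorem hasGIntegral_self : HasGIntegral G f a a (f a * G a) := by
  rw [hasGIntegral_iff]
  intro ε hε
  refine ⟨_, isGauge_univ, fun S hS => ?_⟩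
  have : S = 0 := by
    suffices ∀ b, FineSum G f (fun _ => univ) a b S → b ≤ a → S = 0 from this a hS le_rfl
    clear hS
    intro b hS
    induction hS with
    | nil => intro _; rfl
    | @snoc b c t S h hbc _ _ ih =>
      intro hca
      have h1 : b = c := le_antisymm hbc (hca.trans h.le)
      simp [ih (hbc.trans hca), h1]
  simpa [this] using hε

variable [OrderTopology K] [CompactSpace K]

/-- **Cousin's lemma** on a compact line. The supremum `m` of the points reached from `a` by fine
partitions is itself reached with tag `m`; from `m` one gets further, with tag `m` if `m` is
right-dense, and with the successor of `m` as tag if `m` is right-isolated. -/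
theorem exists_fineSum (G f : K → ℝ) (hδ : IsGauge δ) (hab : a ≤ b) :
    ∃ S, FineSum G f δ a b S := by
  set C : Set K := {x | x ≤ b ∧ ∃ S, FineSum G f δ a x S} with hC
  have haC : a ∈ C := ⟨hab, 0, .nil⟩
  obtain ⟨m, hm⟩ : ∃ m, IsLUB C m := by
    obtain ⟨m, hm, hmax⟩ := isClosed_closure.isCompact.exists_isGreatest ⟨a, subset_closure haC⟩
    exact ⟨m, isLUB_of_mem_closure (fun x hx => hmax (subset_closure hx)) hm⟩
  have hmb : m ≤ b := hm.2 fun x hx => hx.1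
  have hmC : m ∈ C := by
    obtain ⟨c, hcδ, hcC⟩ := mem_closure_iff_nhds.1 (hm.mem_closure ⟨a, haC⟩) _ (hδ.mem_nhds m)
    obtain ⟨S, hS⟩ := hcC.2
    have hcm := hm.1 hcC
    exact ⟨hmb, _, hS.snoc hcm ⟨hcm, le_rfl⟩
      (Ioc_subset_Icc_self.trans ((hδ m).2.1.out hcδ (hδ m).2.2))⟩
  obtain ⟨S, hS⟩ := hmC.2
  rcases hmb.eq_or_lt with rfl | hlt
  · exact ⟨S, hS⟩
  exfalso
  obtain ⟨u, hmu, hu⟩ := exists_Ico_subset_of_mem_nhds (hδ.mem_nhds m) ⟨b, hlt⟩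
  have hmin : m < min u b := lt_min hmu hlt
  by_cases hmid : ∃ c, m < c ∧ c < min u b
  · obtain ⟨c, hmc, hc⟩ := hmid
    refine hmc.not_ge (hm.1 ⟨(hc.trans_le (min_le_right _ _)).le, _,
      hS.snoc hmc.le ⟨le_rfl, hmc.le⟩ fun z hz => hu ⟨hz.1.le, ?_⟩⟩)
    exact hz.2.trans_lt (hc.trans_le (min_le_left _ _))
  · push Not at hmid
    refine hmin.not_ge (hm.1 ⟨min_le_right _ _, _,
      hS.snoc hmin.le ⟨hmin.le, le_rfl⟩ fun z hz => ?_⟩)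
    rw [le_antisymm hz.2 (hmid z hz.1)]
    exact (hδ _).2.2

theorem HasGIntegral.unique {A B : ℝ} (hab : a ≤ b) (hA : HasGIntegral G f a b A)
    (hB : HasGIntegral G f a b B) : A = B := by
  rw [hasGIntegral_iff] at hA hB
  refine eq_of_abs_sub_le_all fun ε hε => ?_
  obtain ⟨δ, hδ, h⟩ := hA (ε / 2) (half_pos hε)
  obtain ⟨δ', hδ', h'⟩ := hB (ε / 2) (half_pos hε)
  obtain ⟨S, hS⟩ := exists_fineSum G f (hδ.inter hδ') hab
  have h1 := abs_lt.1 (h S (hS.mono fun x => inter_subset_left))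
  have h2 := abs_lt.1 (h' S (hS.mono fun x => inter_subset_right))
  exact abs_le.2 ⟨by linarith, by linarith⟩

/-- Fine sums over `[a, c]`, completed by one fine partition of `[c, b]`, are fine sums over
`[a, b]`; so those over `[a, c]` satisfy the Cauchy criterion. -/
theorem GIntegrable.left (h : GIntegrable G f a b) (hac : a ≤ c) (hcb : c ≤ b) :
    GIntegrable G f a c := by
  obtain ⟨A, hA⟩ := h
  rw [hasGIntegral_iff] at hA
  set ℱ : Filter ℝ := ⨅ δ ∈ {δ : K → Set K | IsGauge δ}, 𝓟 {S | FineSum G f δ a c S} with hℱ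
  have hbasis : ℱ.HasBasis IsGauge fun δ => {S | FineSum G f δ a c S} := by
    refine hasBasis_biInf_principal (S := {δ : K → Set K | IsGauge δ}) ?_ ⟨_, isGauge_univ⟩
    intro δ hδ δ' hδ'
    exact ⟨_, IsGauge.inter hδ hδ', fun S hS => hS.mono fun x => inter_subset_left,
      fun S hS => hS.mono fun x => inter_subset_right⟩
  have hne : ℱ.NeBot := hbasis.neBot_iff.2 fun hδ => exists_fineSum G f hδ hac
  have hcauchy : Cauchy ℱ := by
    refine Metric.cauchy_iff.2 ⟨hne, fun ε hε => ?_⟩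
    obtain ⟨δ, hδ, h⟩ := hA (ε / 2) (half_pos hε)
    obtain ⟨T, hT⟩ := exists_fineSum G f hδ hcb
    refine ⟨_, hbasis.mem_of_mem hδ, fun S hS S' hS' => ?_⟩
    have h1 := abs_lt.1 (h _ (FineSum.trans hS hT))
    have h2 := abs_lt.1 (h _ (FineSum.trans hS' hT))
    rw [Real.dist_eq]
    exact abs_lt.2 ⟨by linarith, by linarith⟩
  obtain ⟨B, hB⟩ := CompleteSpace.complete hcauchy
  refine ⟨f a * G a + B, hasGIntegral_iff.2 fun ε hε => ?_⟩
  obtain ⟨δ, hδ, h⟩ := hbasis.mem_iff.1 (hB (Metric.ball_mem_nhds B hε))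
  refine ⟨δ, hδ, fun S hS => ?_⟩
  rw [add_sub_add_left_eq_sub]
  exact h hS

end FineSum

/-! ### The Saks–Henstock lemma -/

section SaksHenstock

variable {K : Type*} [LinearOrder K] [TopologicalSpace K] [OrderTopology K] [CompactSpace K]
  {G f F : K → ℝ} {δ : K → Set K} {a b : K} {ε : ℝ}

/-- The increments of an indefinite integral `F` are approximated by fine sums. -/
theorem exists_fineSum_abs_sub_lt {p : K} (hF : ∀ x, p ≤ x → HasGIntegral G f p x (F x))
    (hδ : IsGauge δ) (hpa : p ≤ a) (hab : a ≤ b) (hε : 0 < ε) :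
    ∃ S, FineSum G f δ a b S ∧ |S - (F b - F a)| < ε := by
  obtain ⟨δ₁, hδ₁, h₁⟩ := hasGIntegral_iff.1 (hF a hpa) (ε / 2) (half_pos hε)
  obtain ⟨δ₂, hδ₂, h₂⟩ := hasGIntegral_iff.1 (hF b (hpa.trans hab)) (ε / 2) (half_pos hε)
  obtain ⟨T, hT⟩ := exists_fineSum G f (hδ₁.inter hδ₂) hpa
  obtain ⟨S, hS⟩ := exists_fineSum G f (hδ.inter hδ₂) hab
  refine ⟨S, hS.mono fun x => inter_subset_left, ?_⟩
  have h1 := abs_lt.1 (h₁ T (hT.mono fun x => inter_subset_left))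
  have h2 := abs_lt.1 (h₂ (T + S) ((hT.mono fun x => inter_subset_right).trans
    (hS.mono fun x => inter_subset_right)))
  exact abs_lt.2 ⟨by linarith, by linarith⟩

theorem eq_of_hasGIntegral_of_eq {p : K} (hG : Monotone G)
    (hF : ∀ x, p ≤ x → HasGIntegral G f p x (F x)) (hpa : p ≤ a) (hab : a ≤ b)
    (h : G a = G b) : F a = F b := by
  refine eq_of_abs_sub_le_all fun ε hε => ?_
  obtain ⟨S, hS, hlt⟩ := exists_fineSum_abs_sub_lt hF isGauge_univ hpa hab hε
  rw [hS.eq_zero_of_eq hG h, zero_sub, neg_sub] at hlt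
  exact hlt.le

variable {ι : Type*} {u v t : ι → K}

/-- A finite family of non-overlapping fine tagged intervals can be completed to a fine partition
whose remaining intervals contribute as little error as desired. The family is treated in the
order of the left endpoints, the gaps being filled by `exists_fineSum_abs_sub_lt`. -/
theorem exists_fineSum_extending {p : K} (hF : ∀ x, p ≤ x → HasGIntegral G f p x (F x))
    (hδ : IsGauge δ) (hpa : p ≤ a) (s : Finset ι) (hau : ∀ i ∈ s, a ≤ u i)
    (huv : ∀ i ∈ s, u i < v i) (ht : ∀ i ∈ s, t i ∈ Icc (u i) (v i))
    (hfine : ∀ i ∈ s, Ioc (u i) (v i) ⊆ δ (t i))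
    (hdisj : ∀ i ∈ s, ∀ j ∈ s, i ≠ j → v i ≤ u j ∨ v j ≤ u i)
    (hab : a ≤ b) (hvb : ∀ i ∈ s, v i ≤ b) (hε : 0 < ε) :
    ∃ S, FineSum G f δ a b S ∧
      |S - (F b - F a) - ∑ i ∈ s, (f (t i) * (G (v i) - G (u i)) - (F (v i) - F (u i)))| < ε := by
  classical
  induction s using Finset.induction_on_max_value u generalizing b ε with
  | empty =>
    simpa using exists_fineSum_abs_sub_lt hF hδ hpa hab hε
  | insert i s his hmax ih =>
    simp only [Finset.forall_mem_insert] at hau huv ht hfine hvb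
    have hvu : ∀ j ∈ s, v j ≤ u i := by
      intro j hj
      have hij : i ≠ j := fun h => his (h ▸ hj)
      refine (hdisj i (by simp) j (by simp [hj]) hij).resolve_left fun h => ?_
      exact (huv.1.trans_le h).not_ge (hmax j hj)
    obtain ⟨S, hS, hSlt⟩ := ih hau.2 huv.2 ht.2 hfine.2
      (fun j hj k hk => hdisj j (by simp [hj]) k (by simp [hk])) hau.1 hvu (half_pos hε)
    obtain ⟨T, hT, hTlt⟩ := exists_fineSum_abs_sub_lt hF hδ
      (hpa.trans (hau.1.trans huv.1.le)) hvb.1 (half_pos hε)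
    refine ⟨_, (hS.snoc huv.1.le ht.1 hfine.1).trans hT, ?_⟩
    rw [Finset.sum_insert his]
    rw [abs_lt] at hSlt hTlt ⊢
    constructor <;> linarith [hSlt.1, hSlt.2, hTlt.1, hTlt.2]

/-- The **Saks–Henstock lemma**: a gauge good for the integral over `[a, b]` is good, without loss,
for every finite family of non-overlapping fine tagged subintervals. -/
theorem abs_sum_le_of_fine (hF : ∀ x, a ≤ x → HasGIntegral G f a x (F x)) (hδ : IsGauge δ)
    (hab : a ≤ b) (hsum : ∀ S, FineSum G f δ a b S → |f a * G a + S - F b| < ε)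
    (s : Finset ι) (hau : ∀ i ∈ s, a ≤ u i) (hvb : ∀ i ∈ s, v i ≤ b)
    (huv : ∀ i ∈ s, u i < v i) (ht : ∀ i ∈ s, t i ∈ Icc (u i) (v i))
    (hfine : ∀ i ∈ s, Ioc (u i) (v i) ⊆ δ (t i))
    (hdisj : ∀ i ∈ s, ∀ j ∈ s, i ≠ j → v i ≤ u j ∨ v j ≤ u i) :
    |∑ i ∈ s, (f (t i) * (G (v i) - G (u i)) - (F (v i) - F (u i)))| ≤ ε := by
  refine le_of_forall_pos_le_add fun η hη => ?_
  obtain ⟨S, hS, hlt⟩ := exists_fineSum_extending hF hδ le_rfl s hau huv ht hfine hdisj hab hvb hη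
  have h1 := hsum S hS
  have h2 : F a = f a * G a := (hF a le_rfl).unique le_rfl hasGIntegral_self
  rw [abs_lt] at h1 hlt
  exact abs_le.2 ⟨by linarith [h1.1, hlt.2], by linarith [h1.2, hlt.1]⟩

/-- Splitting the family according to the sign of the summands puts the absolute values inside
the sum. -/
theorem sum_abs_le_of_fine (hF : ∀ x, a ≤ x → HasGIntegral G f a x (F x)) (hδ : IsGauge δ)
    (hab : a ≤ b) (hsum : ∀ S, FineSum G f δ a b S → |f a * G a + S - F b| < ε)
    (s : Finset ι) (hau : ∀ i ∈ s, a ≤ u i) (hvb : ∀ i ∈ s, v i ≤ b)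
    (huv : ∀ i ∈ s, u i < v i) (ht : ∀ i ∈ s, t i ∈ Icc (u i) (v i))
    (hfine : ∀ i ∈ s, Ioc (u i) (v i) ⊆ δ (t i))
    (hdisj : ∀ i ∈ s, ∀ j ∈ s, i ≠ j → v i ≤ u j ∨ v j ≤ u i) :
    ∑ i ∈ s, |f (t i) * (G (v i) - G (u i)) - (F (v i) - F (u i))| ≤ 2 * ε := by
  classical
  set g : ι → ℝ := fun i => f (t i) * (G (v i) - G (u i)) - (F (v i) - F (u i)) with hg
  have key : ∀ s' ⊆ s, |∑ i ∈ s', g i| ≤ ε := fun s' hs' =>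
    abs_sum_le_of_fine hF hδ hab hsum s' (fun i hi => hau i (hs' hi))
      (fun i hi => hvb i (hs' hi)) (fun i hi => huv i (hs' hi)) (fun i hi => ht i (hs' hi))
      (fun i hi => hfine i (hs' hi)) (fun i hi j hj => hdisj i (hs' hi) j (hs' hj))
  have hpos : ∑ i ∈ s with 0 ≤ g i, |g i| = ∑ i ∈ s with 0 ≤ g i, g i :=
    Finset.sum_congr rfl fun i hi => abs_of_nonneg (Finset.mem_filter.1 hi).2
  have hneg : ∑ i ∈ s with ¬ 0 ≤ g i, |g i| = -∑ i ∈ s with ¬ 0 ≤ g i, g i := by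
    rw [← Finset.sum_neg_distrib]
    exact Finset.sum_congr rfl fun i hi => abs_of_neg (not_le.1 (Finset.mem_filter.1 hi).2)
  rw [← Finset.sum_filter_add_sum_filter_not s (fun i => 0 ≤ g i), hpos, hneg]
  linarith [(abs_le.1 (key _ (Finset.filter_subset (fun i => 0 ≤ g i) s))).2,
    (abs_le.1 (key _ (Finset.filter_subset (fun i => ¬ 0 ≤ g i) s))).1]

end SaksHenstock

/-! ### Left-continuous curves and push-forwards of Lebesgue measure -/

section LeftContinuous

/-- A set of reals that contains a left neighbourhood of each of its points is a countable union
of such neighbourhoods: the Sorgenfrey line is hereditarily Lindelöf. -/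
theorem exists_countable_iUnion_Ioc {V : Set ℝ} {p : ℝ → ℝ} (hp : ∀ s ∈ V, p s < s)
    (hV : ∀ s ∈ V, Ioc (p s) s ⊆ V) : ∃ T ⊆ V, T.Countable ∧ V = ⋃ s ∈ T, Ioc (p s) s := by
  obtain ⟨T, hTV, hT, hTU⟩ := TopologicalSpace.isOpen_biUnion_countable V
    (fun s => Ioo (p s) s) fun _ _ => isOpen_Ioo
  set R := V \ ⋃ s ∈ V, Ioo (p s) s with hR
  -- The points outside all the open intervals are right end points of disjoint intervals.
  have hRc : R.Countable := by
    refine Set.PairwiseDisjoint.countable_of_isOpen (s := fun s => Ioo (p s) s) ?_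
      (fun _ _ => isOpen_Ioo) fun s hs => nonempty_Ioo.2 (hp s hs.1)
    intro s hs s' hs' hne
    refine Set.disjoint_left.2 fun z hz hz' => hne ?_
    rcases lt_trichotomy s s' with h | h | h
    · exact (hs.2 (mem_iUnion₂.2 ⟨s', hs'.1, hz'.1.trans hz.2, h⟩)).elim
    · exact h
    · exact (hs'.2 (mem_iUnion₂.2 ⟨s, hs.1, hz.1.trans hz'.2, h⟩)).elim
  refine ⟨T ∪ R, union_subset hTV sdiff_subset, hT.union hRc, Subset.antisymm ?_ ?_⟩
  · intro s hs
    by_cases hsR : s ∈ R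
    · exact mem_biUnion (Or.inr hsR) ⟨hp s hs, le_rfl⟩
    · have : s ∈ ⋃ s ∈ V, Ioo (p s) s := by
        by_contra h
        exact hsR ⟨hs, h⟩
      rw [← hTU] at this
      obtain ⟨r, hr, hsr⟩ := mem_iUnion₂.1 this
      exact mem_biUnion (Or.inl hr) ⟨hsr.1, hsr.2.le⟩
  · refine iUnion₂_subset fun s hs => hV s ?_
    exact hs.elim (fun h => hTV h) fun h => h.1

variable {K : Type*} [TopologicalSpace K] {φ : ℝ → K}

theorem exists_mapsTo_Ioc (hφ : ∀ s, ContinuousWithinAt φ (Iic s) s) {U : Set K} {s : ℝ}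
    (hU : U ∈ 𝓝 (φ s)) : ∃ p < s, MapsTo φ (Ioc p s) U :=
  mem_nhdsLE_iff_exists_Ioc_subset.1 (hφ s hU)

variable [MeasurableSpace K] [BorelSpace K]

theorem measurable_of_leftContinuous (hφ : ∀ s, ContinuousWithinAt φ (Iic s) s) :
    Measurable φ := by
  refine measurable_of_isOpen fun U hU => ?_
  have h : ∀ s, ∃ p, s ∈ φ ⁻¹' U → p < s ∧ Ioc p s ⊆ φ ⁻¹' U := by
    intro s
    by_cases hs : s ∈ φ ⁻¹' U
    · obtain ⟨p, hp, h⟩ := exists_mapsTo_Ioc hφ (hU.mem_nhds hs)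
      exact ⟨p, fun _ => ⟨hp, h⟩⟩
    · exact ⟨0, fun h => absurd h hs⟩
  choose p hp using h
  obtain ⟨T, -, hT, hTU⟩ := exists_countable_iUnion_Ioc (fun s hs => (hp s hs).1)
    fun s hs => (hp s hs).2
  rw [hTU]
  exact .biUnion hT fun _ _ => measurableSet_Ioc

/-- The preimage of an open set `U` is a countable union of intervals `(p, s]`, each of which is
mapped into a compact subset of `U`; finitely many of them carry almost all of the measure. -/
theorem regular_map_of_leftContinuous [CompactSpace K] [T2Space K]
    (hφ : ∀ s, ContinuousWithinAt φ (Iic s) s) (ν : Measure ℝ) [IsFiniteMeasure ν] :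
    (ν.map φ).Regular := by
  have hmeas := measurable_of_leftContinuous hφ
  have hfin : IsFiniteMeasure (ν.map φ) := inferInstance
  have hinner : (ν.map φ).InnerRegularWRT IsCompact IsOpen := by
    intro U hU r hr
    have h : ∀ s, ∃ p, ∃ C : Set K, s ∈ φ ⁻¹' U →
        p < s ∧ IsCompact C ∧ C ⊆ U ∧ MapsTo φ (Ioc p s) C := by
      intro s
      by_cases hs : s ∈ φ ⁻¹' U
      · obtain ⟨C, hC, hCU, hCc⟩ := local_compact_nhds (hU.mem_nhds hs)
        obtain ⟨p, hp, h⟩ := exists_mapsTo_Ioc hφ hC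
        exact ⟨p, C, fun _ => ⟨hp, hCc, hCU, h⟩⟩
      · exact ⟨0, ∅, fun h => absurd h hs⟩
    choose p C hpC using h
    obtain ⟨T, hTV, hT, hTU⟩ := exists_countable_iUnion_Ioc (fun s hs => (hpC s hs).1)
      fun s hs z hz => (hpC s hs).2.2.1 ((hpC s hs).2.2.2 hz)
    have : Countable T := hT.to_subtype
    rw [Measure.map_apply hmeas hU.measurableSet, hTU, biUnion_eq_iUnion,
      iUnion_eq_iUnion_finset, Directed.measure_iUnion] at hr
    · obtain ⟨F, hF⟩ := lt_iSup_iff.1 hr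
      have hCU : ⋃ i ∈ F, C i ⊆ U := iUnion₂_subset fun i _ => (hpC i (hTV i.2)).2.2.1
      have hCc : IsCompact (⋃ i ∈ F, C i) :=
        F.isCompact_biUnion fun i _ => (hpC i (hTV i.2)).2.1
      refine ⟨_, hCU, hCc, hF.trans_le ?_⟩
      rw [Measure.map_apply hmeas hCc.isClosed.measurableSet]
      refine measure_mono (iUnion₂_subset fun i hi s hs => ?_)
      exact mem_biUnion hi ((hpC i (hTV i.2)).2.2.2 hs)
    · exact Monotone.directed_le fun F F' hFF' => biUnion_subset_biUnion_left hFF'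
  have hweak : (ν.map φ).WeaklyRegular := Measure.InnerRegularWRT.weaklyRegular_of_finite _
    fun U hU r hr => by
      obtain ⟨C, hCU, hC, hlt⟩ := hinner hU r hr
      exact ⟨C, hCU, hC.isClosed, hlt⟩
  exact { innerRegular := hinner }

end LeftContinuous

/-! ### The induced measure -/

section InducedMeasure

variable {K : Type*} [LinearOrder K] [BoundedOrder K] [TopologicalSpace K] [OrderTopology K]
  [CompactSpace K] {G : K → ℝ}

theorem exists_isLeast_le_of_rightContinuous (hGr : ∀ x, ContinuousWithinAt G (Ici x) x)
    {s : ℝ} (hs : s ≤ G ⊤) :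
    ∃ m, IsLeast {x | s ≤ G x} m := by
  have hne : (closure {x | s ≤ G x}).Nonempty := ⟨⊤, subset_closure hs⟩
  obtain ⟨m, hm, hmin⟩ := isClosed_closure.isCompact.exists_isLeast hne
  refine ⟨m, ?_, fun x hx => hmin (subset_closure hx)⟩
  have : (𝓝[{x | s ≤ G x}] m).NeBot := mem_closure_iff_nhdsWithin_neBot.1 hm
  exact ge_of_tendsto ((hGr m).mono fun x hx => hmin (subset_closure hx)) self_mem_nhdsWithin

/-- The generalized inverse of `G`: `quantile G s` is the least `x` with `s ≤ G x`. Arguments above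
`G ⊤`, for which there is no such `x`, are treated as `G ⊤`. For right-continuous `G` the least `x`
exists, and the value `⊤` of the other case does not occur. -/
noncomputable def quantile (G : K → ℝ) (s : ℝ) : K :=
  open scoped Classical in
  if h : ∃ m, IsLeast {x | min s (G ⊤) ≤ G x} m then h.choose else ⊤

/-- The generalized inverse and `G` form a Galois connection. -/
theorem quantile_le_iff (hG : Monotone G) (hGr : ∀ x, ContinuousWithinAt G (Ici x) x)
    {s : ℝ} {x : K} : quantile G s ≤ x ↔ min s (G ⊤) ≤ G x := by
  have h := exists_isLeast_le_of_rightContinuous hGr (min_le_right s (G ⊤))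
  rw [quantile, dif_pos h]
  exact ⟨fun hx => h.choose_spec.1.trans (hG hx), fun hx => h.choose_spec.2 hx⟩

theorem quantile_le_iff_of_mem (hG : Monotone G) (hGr : ∀ x, ContinuousWithinAt G (Ici x) x)
    {s : ℝ} (hs : s ≤ G ⊤) {x : K} : quantile G s ≤ x ↔ s ≤ G x := by
  rw [quantile_le_iff hG hGr, min_eq_left hs]

theorem continuousWithinAt_quantile (hG : Monotone G)
    (hGr : ∀ x, ContinuousWithinAt G (Ici x) x) (s : ℝ) :
    ContinuousWithinAt (quantile G) (Iic s) s := by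
  refine tendsto_order.2 ⟨fun l hl => ?_, fun l hl => ?_⟩
  · rw [← not_le, quantile_le_iff hG hGr, not_le, lt_min_iff] at hl
    filter_upwards [mem_nhdsWithin_of_mem_nhds (Ioi_mem_nhds hl.1)] with s' hs'
    rw [← not_le, quantile_le_iff hG hGr, not_le]
    exact lt_min hs' hl.2
  · filter_upwards [self_mem_nhdsWithin] with s' hs'
    refine lt_of_le_of_lt ?_ hl
    rw [quantile_le_iff hG hGr]
    exact (min_le_min_right _ hs').trans ((quantile_le_iff hG hGr).1 le_rfl)

variable [MeasurableSpace K]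

/-- The Radon measure induced by `G`: the law of the generalized inverse of `G` under Lebesgue
measure on `(0, G ⊤]`. -/
noncomputable def inducedMeasure (G : K → ℝ) : Measure K :=
  (volume.restrict (Ioc 0 (G ⊤))).map (quantile G)

instance : IsFiniteMeasure (inducedMeasure G) := by
  unfold inducedMeasure; infer_instance

variable [BorelSpace K]

theorem inducedMeasure_apply (hG : Monotone G) (hGr : ∀ x, ContinuousWithinAt G (Ici x) x)
    {B : Set K} (hB : MeasurableSet B) :
    inducedMeasure G B = volume (quantile G ⁻¹' B ∩ Ioc 0 (G ⊤)) := by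
  have hmeas := measurable_of_leftContinuous (continuousWithinAt_quantile hG hGr)
  rw [inducedMeasure, Measure.map_apply hmeas hB, Measure.restrict_apply (hmeas hB)]

theorem isInducedMeasure_inducedMeasure (hG : Monotone G)
    (hGr : ∀ x, ContinuousWithinAt G (Ici x) x) : IsInducedMeasure G (inducedMeasure G) := by
  refine ⟨regular_map_of_leftContinuous (continuousWithinAt_quantile hG hGr) _, fun x => ?_⟩
  have : quantile G ⁻¹' Iic x ∩ Ioc 0 (G ⊤) = Ioc 0 (G x) := by
    ext s
    constructor
    · rintro ⟨h, hs⟩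
      exact ⟨hs.1, (quantile_le_iff_of_mem hG hGr hs.2).1 h⟩
    · intro hs
      have hs' : s ≤ G ⊤ := hs.2.trans (hG le_top)
      exact ⟨(quantile_le_iff_of_mem hG hGr hs').2 hs.2, hs.1, hs'⟩
  rw [inducedMeasure_apply hG hGr measurableSet_Iic, this, Real.volume_Ioc, sub_zero]

/-- On points that are not atoms, the induced measure is bounded by the Lebesgue outer measure of
the image under `G`. If `s < G x` for `x = quantile G s`, then `quantile G` is constant on
`[s, G x]`, so `x` is an atom; away from the atoms `quantile G` is thus inverse to `G`. -/
theorem inducedMeasure_le_volume_image (hG : Monotone G)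
    (hGr : ∀ x, ContinuousWithinAt G (Ici x) x) {A : Set K}
    (hA : ∀ x ∈ A, inducedMeasure G {x} = 0) : inducedMeasure G A ≤ volume (G '' A) := by
  set J : Set K := {x | 0 < inducedMeasure G {x}} with hJ
  have hJc : J.Countable := by
    refine Measure.countable_meas_pos_of_disjoint_iUnion (As := fun x : K => ({x} : Set K))
      (fun _ => measurableSet_singleton _) ?_
    intro x y hxy
    simpa using hxy
  set O := toMeasurable volume (G '' A) with hO
  have hOm : MeasurableSet O := measurableSet_toMeasurable _ _
  have hB : MeasurableSet (G ⁻¹' O \ J) := (hG.measurable hOm).diff hJc.measurableSet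
  have hAB : A ⊆ G ⁻¹' O \ J := fun x hx =>
    ⟨subset_toMeasurable _ _ (mem_image_of_mem G hx), by simp [hJ, hA x hx]⟩
  have hBO : quantile G ⁻¹' (G ⁻¹' O \ J) ∩ Ioc 0 (G ⊤) ⊆ O := by
    rintro s ⟨⟨hsO, hsJ⟩, hs⟩
    have hle : s ≤ G (quantile G s) := (quantile_le_iff_of_mem hG hGr hs.2).1 le_rfl
    rcases hle.eq_or_lt with h | h
    · rw [h]
      exact hsO
    refine absurd ?_ hsJ
    rw [hJ, mem_ofPred_eq, inducedMeasure_apply hG hGr (measurableSet_singleton _)]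
    have hsub : Ioc s (G (quantile G s)) ⊆ quantile G ⁻¹' {quantile G s} ∩ Ioc 0 (G ⊤) := by
      intro s' hs'
      have hs'' : s' ≤ G ⊤ := hs'.2.trans (hG le_top)
      refine ⟨le_antisymm ((quantile_le_iff_of_mem hG hGr hs'').2 hs'.2) ?_,
        hs.1.trans hs'.1, hs''⟩
      refine (quantile_le_iff_of_mem hG hGr hs.2).2 (hs'.1.le.trans ?_)
      exact (quantile_le_iff_of_mem hG hGr hs'').1 le_rfl
    refine lt_of_lt_of_le ?_ (measure_mono hsub)
    simpa using h
  calc inducedMeasure G A ≤ inducedMeasure G (G ⁻¹' O \ J) := measure_mono hAB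
    _ ≤ volume O := by
        rw [inducedMeasure_apply hG hGr hB]
        exact measure_mono hBO
    _ = volume (G '' A) := measure_toMeasurable _

end InducedMeasure

/-! ### Left values -/

section LeftValue

variable {K : Type*} [LinearOrder K] [BoundedOrder K]

/-- Every point is the least one, has a predecessor, or is left-dense. -/
theorem eq_bot_or_covBy_or_leftDense (x : K) : x = ⊥ ∨ (∃ y, y ⋖ x) ∨ LeftDense x := by
  by_cases hx : x = ⊥
  · exact Or.inl hx
  · by_cases h : LeftIsolated x
    · exact Or.inr (Or.inl h)
    · exact Or.inr (Or.inr ⟨hx, h⟩)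

variable [TopologicalSpace K] {G : K → ℝ} {x y : K}

theorem leftValue_bot (G : K → ℝ) : leftValue G ⊥ = 0 := by
  simp [leftValue]

theorem leftValue_of_covBy (G : K → ℝ) (h : y ⋖ x) : leftValue G x = G y := by
  have hx : LeftIsolated x := ⟨y, h⟩
  rw [leftValue, if_neg h.lt.ne_bot, dif_pos hx, hx.choose_spec.unique_left h]

variable [OrderTopology K]

theorem LeftDense.neBot (hx : LeftDense x) : (𝓝[<] x).NeBot := by
  rw [neBot_iff, Ne, nhdsLT_eq_bot_iff, isBot_iff_eq_bot, not_or]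
  exact hx

theorem LeftDense.leftValue_eq (hx : LeftDense x) {l : ℝ} (h : Tendsto G (𝓝[<] x) (𝓝 l)) :
    leftValue G x = l := by
  have := hx.neBot
  rw [leftValue, if_neg hx.1, dif_neg hx.2]
  exact h.limUnder_eq

theorem LeftDense.tendsto_leftValue (hx : LeftDense x) (hG : Monotone G) :
    Tendsto G (𝓝[<] x) (𝓝 (leftValue G x)) := by
  have h := hG.tendsto_nhdsLT x
  rwa [hx.leftValue_eq h]

theorem leftValue_le (hG : Monotone G) {c : ℝ} (hc : 0 ≤ c) (h : ∀ y < x, G y ≤ c) :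
    leftValue G x ≤ c := by
  rcases eq_bot_or_covBy_or_leftDense x with rfl | ⟨z, hz⟩ | hx
  · rwa [leftValue_bot]
  · rw [leftValue_of_covBy G hz]
    exact h z hz.lt
  · have := hx.neBot
    refine le_of_tendsto (hx.tendsto_leftValue hG) ?_
    filter_upwards [self_mem_nhdsWithin] with z hz using h z hz

variable [CompactSpace K] [MeasurableSpace K] [BorelSpace K]

theorem inducedMeasure_singleton_eq_zero (hG : Monotone G)
    (hGr : ∀ x, ContinuousWithinAt G (Ici x) x) (hx : leftValue G x = G x) :
    inducedMeasure G {x} = 0 := by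
  rw [inducedMeasure_apply hG hGr (measurableSet_singleton _)]
  refine measure_mono_null (t := {G x}) ?_ (by simp)
  rintro s ⟨rfl, hs⟩
  refine le_antisymm ((quantile_le_iff_of_mem hG hGr hs.2).1 le_rfl) ?_
  rw [← hx]
  refine leftValue_le hG hs.1.le fun y hy => ?_
  rw [← not_le, quantile_le_iff_of_mem hG hGr hs.2, not_le] at hy
  exact hy.le

/-- The points without jump at which `G` is locally constant have a neighbourhood that
`quantile G` does not meet on `(0, G ⊤]`. -/
theorem inducedMeasure_locallyConstant_eq_zero (hG : Monotone G)
    (hGr : ∀ x, ContinuousWithinAt G (Ici x) x) :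
    inducedMeasure G {x | leftValue G x = G x ∧ ∃ V ∈ 𝓝 x, ∃ c, ∀ y ∈ V, G y = c} = 0 := by
  set O : Set K := interior {z | 0 < G z → ∃ y < z, G y = G z} with hO
  refine measure_mono_null (t := O) ?_ ?_
  · rintro x ⟨hx, V, hV, c, hc⟩
    have hcx : ∀ z ∈ V, G z = G x := fun z hz => (hc z hz).trans (hc x (mem_of_mem_nhds hV)).symm
    rw [hO, mem_interior_iff_mem_nhds]
    rcases eq_bot_or_covBy_or_leftDense x with rfl | ⟨y, hy⟩ | hxd
    · filter_upwards [hV] with z hz hpos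
      rw [hcx z hz, ← hx, leftValue_bot] at hpos
      exact absurd hpos (lt_irrefl _)
    · filter_upwards [hV, Ioi_mem_nhds hy.lt] with z hz hyz _
      exact ⟨y, hyz, by rw [hcx z hz, ← hx, leftValue_of_covBy G hy]⟩
    · have := hxd.neBot
      obtain ⟨y, hyx, hyV⟩ := Filter.nonempty_of_mem (inter_mem_nhdsWithin (Iio x) hV)
      filter_upwards [hV, Ioi_mem_nhds hyx] with z hz hyz _
      exact ⟨y, hyz, by rw [hcx z hz, hcx y hyV]⟩
  · rw [inducedMeasure_apply hG hGr isOpen_interior.measurableSet]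
    convert measure_empty (μ := (volume : Measure ℝ))
    refine eq_empty_of_forall_notMem ?_
    rintro s ⟨hsO, hs⟩
    have hle := (quantile_le_iff_of_mem hG hGr hs.2).1 le_rfl
    obtain ⟨y, hy, hGy⟩ := interior_subset hsO (hs.1.trans_le hle)
    exact hy.not_ge ((quantile_le_iff_of_mem hG hGr hs.2).2 (hGy ▸ hle))

end LeftValue

/-! ### Local behaviour of the indefinite integral -/

section IndefiniteIntegral

variable {K : Type*} [LinearOrder K] [BoundedOrder K] [TopologicalSpace K] [OrderTopology K]
  [CompactSpace K] {G f F : K → ℝ} {x : K}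

theorem exists_gauge_abs_sub_le (hF : ∀ x, HasGIntegral G f ⊥ x (F x)) {ε : ℝ} (hε : 0 < ε) :
    ∃ δ : K → Set K, IsGauge δ ∧ ∀ u v t, u < v → t ∈ Icc u v → Ioc u v ⊆ δ t →
      |F v - F u - f t * (G v - G u)| ≤ ε := by
  obtain ⟨δ, hδ, hsum⟩ := hasGIntegral_iff.1 (hF ⊤) ε hε
  refine ⟨δ, hδ, fun u v t huv ht hs => ?_⟩
  have h := abs_sum_le_of_fine (ι := Unit) (u := fun _ => u) (v := fun _ => v) (t := fun _ => t)
    (fun x _ => hF x) hδ bot_le hsum {()} (by simp) (by simp) (by simpa using huv)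
    (by simpa using ht) (by simpa using hs) (by simp)
  rw [abs_sub_comm]
  simpa using h

theorem eventually_abs_sub_le (hF : ∀ x, HasGIntegral G f ⊥ x (F x)) (x : K) {ε : ℝ}
    (hε : 0 < ε) : ∀ᶠ y in 𝓝 x, |F y - F x - f x * (G y - G x)| ≤ ε := by
  obtain ⟨δ, hδ, h⟩ := exists_gauge_abs_sub_le hF hε
  filter_upwards [hδ.mem_nhds x] with y hy
  rcases lt_trichotomy x y with hxy | rfl | hxy
  · exact h x y x hxy ⟨le_rfl, hxy.le⟩
      (Ioc_subset_Icc_self.trans ((hδ x).2.1.out (hδ x).2.2 hy))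
  · simpa using hε.le
  · have := h y x x hxy ⟨hxy.le, le_rfl⟩
      (Ioc_subset_Icc_self.trans ((hδ x).2.1.out hy (hδ x).2.2))
    rw [← abs_neg]
    convert! this using 2
    ring

/-- Near `x`, the increments of `F` and of `f x • G` agree up to a term tending to `0`. -/
theorem tendsto_sub_sub (hF : ∀ x, HasGIntegral G f ⊥ x (F x)) (x : K) :
    Tendsto (fun y => F y - F x - f x * (G y - G x)) (𝓝 x) (𝓝 0) := by
  refine Metric.nhds_basis_closedBall.tendsto_right_iff.2 fun ε hε => ?_
  filter_upwards [eventually_abs_sub_le hF x hε] with y hy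
  simpa [Real.dist_eq] using hy

theorem tendsto_nhdsLT_indefinite (hG : Monotone G) (hF : ∀ x, HasGIntegral G f ⊥ x (F x))
    (hx : LeftDense x) :
    Tendsto F (𝓝[<] x) (𝓝 (F x - f x * (G x - leftValue G x))) := by
  have h := ((tendsto_sub_sub hF x).mono_left (nhdsWithin_le_nhds (s := Iio x))).add
    (((hx.tendsto_leftValue hG).sub_const (G x)).const_mul (f x) |>.const_add (F x))
  convert h using 2 <;> ring

theorem continuousWithinAt_Ioi_indefinite (hGr : ContinuousWithinAt G (Ici x) x)
    (hF : ∀ x, HasGIntegral G f ⊥ x (F x)) : Tendsto F (𝓝[>] x) (𝓝 (F x)) := by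
  have hG : Tendsto G (𝓝[>] x) (𝓝 (G x)) := hGr.mono Ioi_subset_Ici_self
  have h := ((tendsto_sub_sub hF x).mono_left (nhdsWithin_le_nhds (s := Ioi x))).add
    ((hG.sub_const (G x)).const_mul (f x) |>.const_add (F x))
  convert h using 2 <;> ring

/-- The jump of the indefinite integral at `x` is `f x` times the jump of `G`. At a point with
predecessor `y` this holds since `(y, x] = {x}` is contained in every gauge. -/
theorem sub_leftValue_indefinite (hG : Monotone G) (hF : ∀ x, HasGIntegral G f ⊥ x (F x)) (x : K) :
    F x - leftValue F x = f x * (G x - leftValue G x) := by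
  rcases eq_bot_or_covBy_or_leftDense x with rfl | ⟨y, hy⟩ | hx
  · rw [leftValue_bot, leftValue_bot, (hF ⊥).unique le_rfl hasGIntegral_self]
    ring
  · rw [leftValue_of_covBy F hy, leftValue_of_covBy G hy]
    refine eq_of_abs_sub_le_all fun ε hε => ?_
    obtain ⟨δ, hδ, h⟩ := exists_gauge_abs_sub_le hF hε
    refine h y x x hy.lt ⟨hy.le, le_rfl⟩ ?_
    rw [hy.Ioc_eq, singleton_subset_iff]
    exact (hδ x).2.2
  · rw [hx.leftValue_eq (tendsto_nhdsLT_indefinite hG hF hx)]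
    ring

/-- At a jump of `G` the indefinite integral is always differentiable. -/
theorem hasGDerivAt_of_leftValue_ne (hG : Monotone G) (hGn : ∀ x, 0 ≤ G x)
    (hGr : ContinuousWithinAt G (Ici x) x) (hF : ∀ x, HasGIntegral G f ⊥ x (F x))
    (hx : leftValue G x ≠ G x) : HasGDerivAt G F (f x) x := by
  have hlt : leftValue G x < G x :=
    (leftValue_le hG (hGn x) fun y hy => hG hy.le).lt_of_ne hx
  refine Or.inr ⟨hx, ⟨fun h => ⟨_, tendsto_nhdsLT_indefinite hG hF h⟩,
    fun _ => continuousWithinAt_Ioi_indefinite hGr hF⟩, fun ε hε => ?_⟩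
  refine ⟨_, eventually_abs_sub_le hF x (mul_pos hε (sub_pos.2 hlt)), fun y ⟨hy, hxy⟩ => ?_⟩
  have hGxy : G x ≤ G y := hG hxy
  have hjump := sub_leftValue_indefinite hG hF x
  have heq : F y - leftValue F x - f x * (G y - leftValue G x) =
      F y - F x - f x * (G y - G x) := by linear_combination hjump
  rw [heq, abs_of_nonneg (by linarith : 0 ≤ G y - leftValue G x)]
  exact le_trans hy (mul_le_mul_of_nonneg_left (by linarith) hε.le)

/-- The image under `G` of the set where the difference quotients of `F` stay away from `f` is
null. By the Saks–Henstock lemma, disjoint fine intervals on which the error is at least `c` times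
the increment of `G` have small total increment; by the Vitali covering theorem on the line, the
images of such intervals, enlarged by a factor `5`, cover the image of the set. -/
theorem volume_image_eq_zero (hG : Monotone G) (hF : ∀ x, HasGIntegral G f ⊥ x (F x)) {c : ℝ}
    (hc : 0 < c) {E : Set K} (hE : ∀ x ∈ E, ∀ V ∈ 𝓝 x, ∃ y ∈ V,
      c * |G y - G x| < |F y - F x - f x * (G y - G x)|) : volume (G '' E) = 0 := by
  suffices ∀ η > 0, volume (G '' E) ≤ ENNReal.ofReal η by
    refine le_antisymm (ENNReal.le_of_forall_pos_le_add fun η hη _ => ?_) bot_le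
    simpa using this η hη
  intro η hη
  obtain ⟨δ, hδ, hsum⟩ := hasGIntegral_iff.1 (hF ⊤) (c * (η / 10)) (by positivity)
  have hE' : ∀ x, ∃ y, x ∈ E → y ∈ δ x ∧
      c * |G y - G x| < |F y - F x - f x * (G y - G x)| := by
    intro x
    by_cases hx : x ∈ E
    · obtain ⟨y, hy⟩ := hE x hx _ (hδ.mem_nhds x)
      exact ⟨y, fun _ => hy⟩
    · exact ⟨x, fun h => absurd h hx⟩
  choose y hyE using hE'
  set u : K → K := fun x => min x (y x) with hu
  set v : K → K := fun x => max x (y x) with hv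
  have huv : ∀ x, u x ≤ v x := fun x => min_le_max
  have hx : ∀ x, x ∈ Icc (u x) (v x) := fun x => ⟨min_le_left _ _, le_max_left _ _⟩
  have hsub : ∀ x ∈ E, Ioc (u x) (v x) ⊆ δ x := by
    intro x hxE
    refine Ioc_subset_Icc_self.trans ?_
    have := (hδ x).2.1.uIcc_subset (hδ x).2.2 (hyE x hxE).1
    exact this
  have herr : ∀ x ∈ E, c * (G (v x) - G (u x)) <
      |f x * (G (v x) - G (u x)) - (F (v x) - F (u x))| := by
    intro x hxE
    have h := (hyE x hxE).2
    rcases le_total x (y x) with hxy | hxy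
    · simp only [hu, hv, min_eq_left hxy, max_eq_right hxy]
      rwa [abs_of_nonneg (sub_nonneg.2 (hG hxy)), ← abs_neg, neg_sub] at h
    · simp only [hu, hv, min_eq_right hxy, max_eq_left hxy]
      rw [abs_sub_comm (G (y x)), abs_of_nonneg (sub_nonneg.2 (hG hxy))] at h
      convert! h using 2
      ring
  -- Where `G` does not increase, neither does `F`, so the chosen intervals are not degenerate.
  have hpos : ∀ x ∈ E, G (u x) < G (v x) := by
    intro x hxE
    refine (hG (huv x)).lt_of_ne fun h => ?_
    have hFuv := eq_of_hasGIntegral_of_eq hG (fun x _ => hF x) bot_le (huv x) h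
    have := herr x hxE
    simp [h, hFuv] at this
  have hball : ∀ x, Metric.closedBall ((G (u x) + G (v x)) / 2) ((G (v x) - G (u x)) / 2) =
      Icc (G (u x)) (G (v x)) := by
    intro x
    rw [Real.closedBall_eq_Icc]
    congr 1 <;> ring
  obtain ⟨t, htE, hdisj, hcov⟩ := Vitali.exists_disjoint_subfamily_covering_enlargement_closedBall
    E (fun x => (G (u x) + G (v x)) / 2) (fun x => (G (v x) - G (u x)) / 2) ((G ⊤ - G ⊥) / 2)
    (fun x _ => by linarith [hG (le_top : v x ≤ ⊤), hG (bot_le : ⊥ ≤ u x)]) 5 (by norm_num)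
  simp only [hball] at hdisj hcov
  have htc : t.Countable := hdisj.countable_of_nonempty_interior fun x hxt => by
    rw [interior_Icc]
    exact nonempty_Ioo.2 (hpos x (htE hxt))
  have hcover : G '' E ⊆ ⋃ x ∈ t, Metric.closedBall ((G (u x) + G (v x)) / 2)
      (5 * ((G (v x) - G (u x)) / 2)) := by
    rintro _ ⟨x, hxE, rfl⟩
    obtain ⟨b, hbt, hb⟩ := hcov x hxE
    exact mem_biUnion hbt (hb ⟨hG (hx x).1, hG (hx x).2⟩)
  have hfin : ∀ s : Finset t, ∑ x ∈ s, (G (v (x : t)) - G (u (x : t))) ≤ η / 5 := by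
    intro s
    have hnonoverlap : ∀ i ∈ s, ∀ j ∈ s, i ≠ j → v (i : K) ≤ u (j : K) ∨ v (j : K) ≤ u i := by
      intro i _ j _ hij
      by_contra! h
      have hd := hdisj i.2 j.2 fun h => hij (Subtype.ext h)
      have hi : G (max (u i) (u j)) ∈ Icc (G (u i)) (G (v i)) :=
        ⟨hG (le_max_left _ _), hG (max_le (huv i) h.1.le)⟩
      have hj : G (max (u i) (u j)) ∈ Icc (G (u j)) (G (v j)) :=
        ⟨hG (le_max_right _ _), hG (max_le h.2.le (huv j))⟩
      exact Set.disjoint_left.1 hd hi hj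
    have hSH := sum_abs_le_of_fine (u := fun x : t => u x) (v := fun x : t => v x)
      (t := fun x : t => (x : K)) (fun x _ => hF x) hδ bot_le hsum s (fun _ _ => bot_le)
      (fun _ _ => le_top) (fun i _ => (huv i).lt_of_ne fun h => (hpos i (htE i.2)).ne (h ▸ rfl))
      (fun i _ => hx i) (fun i _ => hsub i (htE i.2)) hnonoverlap
    have hle : c * ∑ x ∈ s, (G (v (x : t)) - G (u (x : t))) ≤ c * (η / 5) := by
      rw [Finset.mul_sum]
      refine (Finset.sum_le_sum fun (i : t) _ => (herr i (htE i.2)).le).trans (hSH.trans ?_)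
      linarith
    exact le_of_mul_le_mul_left hle hc
  have : Countable t := htc.to_subtype
  calc volume (G '' E) ≤ ∑' x : t, volume (Metric.closedBall ((G (u x) + G (v x)) / 2)
        (5 * ((G (v x) - G (u x)) / 2))) :=
        (measure_mono hcover).trans (measure_biUnion_le _ htc _)
    _ = ∑' x : t, ENNReal.ofReal (5 * (G (v x) - G (u x))) := by
        simp only [Real.volume_closedBall]
        congr! 3
        ring
    _ ≤ ENNReal.ofReal η := by
        rw [ENNReal.tsum_eq_iSup_sum]
        refine iSup_le fun s => ?_
        rw [← ENNReal.ofReal_sum_of_nonneg, ← Finset.mul_sum]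
        · exact ENNReal.ofReal_le_ofReal (by linarith [hfin s])
        · intro x _
          have := hG (huv x)
          linarith

end IndefiniteIntegral

end CompactLine

/-! ### Differentiability almost everywhere -/

open CompactLine in
theorem theorem3p3 {K : Type*} [LinearOrder K] [BoundedOrder K] [TopologicalSpace K]
    [OrderTopology K] [CompactSpace K] [MeasurableSpace K] [BorelSpace K]
    (G : K → ℝ) (hG_mono : Monotone G) (hG_nonneg : ∀ x, 0 ≤ G x)
    (hG_right : ∀ x, ContinuousWithinAt G (Set.Ici x) x)
    (f : K → ℝ) (hf : CompactLine.GIntegrable G f ⊥ ⊤) :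
    (∀ x, CompactLine.GIntegrable G f ⊥ x) ∧
    ∃ Z : Set K, CompactLine.IsGNull G Z ∧
      ∀ x, x ∉ Z →
        CompactLine.HasGDerivAt G (fun y => CompactLine.gIntegral G f ⊥ y) (f x) x := by
  have hint : ∀ x, GIntegrable G f ⊥ x := fun x => hf.left bot_le le_top
  refine ⟨hint, ?_⟩
  set F : K → ℝ := fun y => gIntegral G f ⊥ y
  have hF : ∀ x, HasGIntegral G f ⊥ x (F x) := fun x => (hint x).hasGIntegral
  set E : ℕ → Set K := fun n => {x | leftValue G x = G x ∧ ∀ V ∈ 𝓝 x, ∃ y ∈ V,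
    1 / ((n : ℝ) + 1) * |G y - G x| < |F y - F x - f x * (G y - G x)|}
  have hE : ∀ n, inducedMeasure G (E n) = 0 := fun n =>
    le_antisymm ((inducedMeasure_le_volume_image hG_mono hG_right fun x hx =>
      inducedMeasure_singleton_eq_zero hG_mono hG_right hx.1).trans
      (volume_image_eq_zero hG_mono hF Nat.one_div_pos_of_nat fun x hx => hx.2).le) bot_le
  refine ⟨{x | leftValue G x = G x ∧ ∃ V ∈ 𝓝 x, ∃ c, ∀ y ∈ V, G y = c} ∪ ⋃ n, E n,
    ⟨_, isInducedMeasure_inducedMeasure hG_mono hG_right,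
      measure_union_null (inducedMeasure_locallyConstant_eq_zero hG_mono hG_right)
        (measure_iUnion_null hE)⟩, fun x hx => ?_⟩
  by_cases hjump : leftValue G x = G x
  · rw [mem_union, not_or, mem_iUnion, not_exists] at hx
    have hFx := sub_leftValue_indefinite hG_mono hF x
    refine Or.inl ⟨hjump, fun _ => ?_, fun V hV hc => hx.1 ⟨hjump, V, hV, hc⟩, fun ε hε => ?_⟩
    · rw [hjump, sub_self, mul_zero] at hFx
      linarith
    · obtain ⟨n, hn⟩ := exists_nat_one_div_lt hε
      have hxn : ¬ ∀ V ∈ 𝓝 x, ∃ y ∈ V,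
          1 / ((n : ℝ) + 1) * |G y - G x| < |F y - F x - f x * (G y - G x)| :=
        fun h => hx.2 n ⟨hjump, h⟩
      push Not at hxn
      obtain ⟨V, hV, h⟩ := hxn
      exact ⟨V, hV, fun y hy => (h y hy).trans
        (mul_le_mul_of_nonneg_right hn.le (abs_nonneg _))⟩
  · exact hasGDerivAt_of_leftValue_ne hG_mono hG_nonneg (hG_right x) hF hjump
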